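/- Let $R$ be a ring with unit; modules are left $R$-modules. An ideal $\mathcal I$ is an additive subfunctor of the bifunctor $\mathrm{Hom}_R$: a subgroup $\mathcal I(A,B)\subseteq\mathrm{Hom}_R(A,B)$ for all modules $A,B$, such that $h'\circ i\circ h$ is in $\mathcal I$ whenever $i$ is in $\mathcal I$ and $h,h'$ are composable homomorphisms. For an ideal $\mathcal I$ put $$\mathcal I^\perp=\{\,g : \mathrm{Ext}^1_R(i,g)=0\ \text{for all } i\in\mathcal I\,\},$$ where for $i:A\to B$ and $g:U\to V$ the map $\mathrm{Ext}^1_R(i,g):\mathrm{Ext}^1_R(B,U)\to\mathrm{Ext}^1_R(A,V)$ is the induced one; $\mathcal I^\perp$ is again an ideal. For an ideal $\mathcal J$, a $\mathcal J$-preenvelope of a module $U$ is a homomorphism $j:U\to V$ in $\mathcal J$ such that every homomorphism $j':U\to V'$ in $\mathcal J$ is of the form $j'=h\circ j$ for some $h:V\to V'$; $\mathcal J$ is preenveloping if every module has a $\mathcal J$-preenvelope. Theorem. Let $\mathcal I$ be the ideal generated by a set of homomorphisms $f_k:M_k\to N_k$ $(k\in K)$, i.e. the smallest ideal containing all $f_k$.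 Then $\mathcal I^\perp$ is preenveloping. More precisely, for every module $U$ there is a cardinal $\kappa$, depending only on $\mathcal I$ and $|U|$, with the following property: the homomorphisms $g:U\to V$ in $\mathcal I^\perp$ with $|V|\le\kappa$ have a set $\{g_j:U\to V_j\}_{j\in J}$ of representatives up to isomorphism under $U$ (exactly one $g_j$ for each isomorphism class), and for every such set of representatives the homomorphism $$U\to\prod_{j\in J}V_j,\qquad x\mapsto (g_j(x))_{j\in J},$$ is an $\mathcal I^\perp$-preenvelope of $U$. -/

import Mathlib

open CategoryTheory CategoryTheory.Abelian

universe u v w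

/-- An ideal of the category of left `R`-modules: an additive subfunctor of the bifunctor `Hom_R`,
that is, a choice of a subgroup of every `Hom_R(A, B)` which is stable under precomposition and
postcomposition with arbitrary homomorphisms. -/
structure HomIdeal (R : Type u) [Ring R] where
  /-- the subgroup of the homomorphisms `A ⟶ B` that lie in the ideal -/
  homs : ∀ A B : ModuleCat.{v} R, AddSubgroup (A ⟶ B)
  precomp_mem : ∀ {A' A B : ModuleCat.{v} R} (h : A' ⟶ A) {g : A ⟶ B},
    g ∈ homs A B → h ≫ g ∈ homs A' B
  postcomp_mem : ∀ {A B B' : ModuleCat.{v} R} {g : A ⟶ B} (h : B ⟶ B'),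
    g ∈ homs A B → g ≫ h ∈ homs A B'

namespace HomIdeal

variable {R : Type u} [Ring R]

/-- The ideal generated by a family of homomorphisms `f k : M k ⟶ N k`: the intersection of all
ideals that contain every `f k`. -/
def span {K : Type w} {M N : K → ModuleCat.{v} R} (f : ∀ k, M k ⟶ N k) : HomIdeal.{u, v} R where
  homs A B :=
    { carrier := {g | ∀ I : HomIdeal.{u, v} R, (∀ k, f k ∈ I.homs (M k) (N k)) → g ∈ I.homs A B}
      zero_mem' := fun I _ => (I.homs A B).zero_mem
      add_mem' := fun ha hb I hI => (I.homs A B).add_mem (ha I hI) (hb I hI)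
      neg_mem' := fun ha I hI => (I.homs A B).neg_mem (ha I hI) }
  precomp_mem h _ hg I hI := I.precomp_mem h (hg I hI)
  postcomp_mem h hg I hI := I.postcomp_mem h (hg I hI)

/-- The vanishing of `Ext¹(i, g) : Ext¹(B, U) → Ext¹(A, V)`, `ξ ↦ g ∘ ξ ∘ i`, for
`i : A ⟶ B` and `g : U ⟶ V`. -/
def ExtOneVanishes [Small.{v} R] {A B U V : ModuleCat.{v} R} (i : A ⟶ B) (g : U ⟶ V) : Prop :=
  ∀ ξ : Ext.{v} B U 1,
    (Ext.mk₀ i).comp (ξ.comp (Ext.mk₀ g) (add_zero 1)) (zero_add 1) = 0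

/-- The right orthogonal `I^⊥` of an ideal `I`: the ideal of all homomorphisms `g` such that
`Ext¹(i, g) = 0` for all `i` in `I`. -/
def perp [Small.{v} R] (I : HomIdeal.{u, v} R) : HomIdeal.{u, v} R where
  homs U V :=
    { carrier := {g | ∀ (A B : ModuleCat.{v} R) (i : A ⟶ B), i ∈ I.homs A B → ExtOneVanishes i g}
      zero_mem' := fun A B i _ ξ => by simp
      add_mem' := fun {a b} ha hb A B i hi ξ => by
        rw [Ext.mk₀_add, Ext.comp_add, Ext.comp_add, ha A B i hi ξ, hb A B i hi ξ, add_zero]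
      neg_mem' := fun {a} ha A B i hi ξ => by
        have h : Ext.mk₀ (-a) = -Ext.mk₀ a :=
          eq_neg_of_add_eq_zero_left (by rw [← Ext.mk₀_add]; simp)
        rw [h, Ext.comp_neg, Ext.comp_neg, ha A B i hi ξ, neg_zero] }
  precomp_mem {U' U V} h {g} hg A B i hi ξ := by
    have := hg A B i hi (ξ.comp (Ext.mk₀ h) (add_zero 1))
    rwa [Ext.comp_assoc_of_third_deg_zero, Ext.mk₀_comp_mk₀] at this
  postcomp_mem {U V V'} g h hg A B i hi ξ := by
    have := congrArg (fun x => x.comp (Ext.mk₀ h) (add_zero 1)) (hg A B i hi ξ)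
    simpa using this

/-- `j : U ⟶ V` is a `J`-preenvelope of `U`: it lies in `J`, and every homomorphism in `J` with
domain `U` factors through `j`. -/
def IsPreenvelope (J : HomIdeal.{u, v} R) {U V : ModuleCat.{v} R} (j : U ⟶ V) : Prop :=
  j ∈ J.homs U V ∧
    ∀ (V' : ModuleCat.{v} R) (j' : U ⟶ V'), j' ∈ J.homs U V' → ∃ h : V ⟶ V', j ≫ h = j'

/-- An ideal `J` is preenveloping if every module has a `J`-preenvelope. -/
def IsPreenveloping (J : HomIdeal.{u, v} R) : Prop :=
  ∀ U : ModuleCat.{v} R, ∃ (V : ModuleCat.{v} R) (j : U ⟶ V), J.IsPreenvelope j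

/-- The family `g s : U ⟶ V s` is the set of all homomorphisms in `J` with domain `U` and codomain
of cardinality at most `c`, up to isomorphism under `U`: it consists of such homomorphisms, and
every such homomorphism is isomorphic to `g s` for exactly one `s`. -/
def IsAllSmallMaps (J : HomIdeal.{u, v} R) (c : Cardinal.{v}) {U : ModuleCat.{v} R}
    {S : Type v} {V : S → ModuleCat.{v} R} (g : ∀ s, U ⟶ V s) : Prop :=
  (∀ s, g s ∈ J.homs U (V s) ∧ Cardinal.mk (V s) ≤ c) ∧
    ∀ (W : ModuleCat.{v} R) (h : U ⟶ W), h ∈ J.homs U W → Cardinal.mk W ≤ c →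
      ∃! s, ∃ e : V s ≅ W, g s ≫ e.hom = h

/-- The homomorphism `U ⟶ ∏ₛ V s`, `x ↦ (g s x)ₛ`. -/
def toProduct {U : ModuleCat.{v} R} {S : Type v} {V : S → ModuleCat.{v} R} (g : ∀ s, U ⟶ V s) :
    U ⟶ ModuleCat.of R (∀ s, V s) :=
  ModuleCat.ofHom (LinearMap.pi fun s => (g s).hom)

end HomIdeal

/-! For fixed `g`, the maps `i` with `Ext¹(i, g) = 0` form an ideal, so orthogonality need only be
tested on the generators. Pulling back a projective presentation of `N k` along `f k` gives `ι k : L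
k ⟶ E k`, and `Ext¹(f k, g) = 0` says that `φ ≫ g` extends along `ι k` for every `φ : L k ⟶ U`. The
simultaneous pushout `q : U ⟶ Q` of all these `φ` is therefore in the orthogonal, and every
orthogonal map out of `U` factors through it. As `Q` has bounded size, `q` is isomorphic to a
component of the product map, which thus inherits the factorization property; its own orthogonality
is checked componentwise. -/

open Limits in
/-- The pullback of the extension `0 ⟶ kernel p ⟶ P ⟶ B ⟶ 0` along `i : A ⟶ B`. -/
theorem CategoryTheory.Abelian.shortExact_pullback {C : Type u} [Category.{v} C] [Abelian C]
    {P A B : C} (p : P ⟶ B) [Epi p] (i : A ⟶ B) :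
    (ShortComplex.mk (pullback.lift (f := p) (g := i) (kernel.ι p) 0 (by simp)) (pullback.snd p i)
      (pullback.lift_snd _ _ _)).ShortExact := by
  have hι := pullback.lift_fst (f := p) (g := i) (kernel.ι p) 0 (by simp)
  have hm : Mono (pullback.lift (f := p) (g := i) (kernel.ι p) 0 (by simp)) := by
    have : Mono (pullback.lift (f := p) (g := i) (kernel.ι p) 0 (by simp) ≫ pullback.fst p i) := by
      rw [hι]; infer_instance
    exact mono_of_mono _ (pullback.fst p i)
  refine ⟨ShortComplex.exact_of_f_is_kernel _ (KernelFork.IsLimit.ofι' _ _ fun {T} k hk => ?_)⟩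
  have hk' : k ≫ pullback.snd p i = 0 := hk
  have h0 : (k ≫ pullback.fst p i) ≫ p = 0 := by
    rw [Category.assoc, pullback.condition, reassoc_of% hk', zero_comp]
  refine ⟨kernel.lift p (k ≫ pullback.fst p i) h0, ?_⟩
  apply pullback.hom_ext
  · rw [Category.assoc, hι, kernel.lift_ι]
  · rw [Category.assoc, hk', pullback.lift_snd, comp_zero]

open Limits in
/-- Vanishing of `Ext¹(i, -)` is an extension property along a fixed homomorphism `ι : L ⟶ E`, where
`0 ⟶ L ⟶ E ⟶ A ⟶ 0` is the pullback along `i : A ⟶ B` of a projective presentation of `B`. -/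
theorem HomIdeal.exists_extOneVanishes_iff_extends {R : Type u} [Ring R] [Small.{v} R]
    {A B : ModuleCat.{v} R} (i : A ⟶ B) :
    ∃ (L E : ModuleCat.{v} R) (ι : L ⟶ E), ∀ {U V : ModuleCat.{v} R} (g : U ⟶ V),
      ExtOneVanishes i g ↔ ∀ φ : L ⟶ U, ∃ ψ : E ⟶ V, ι ≫ ψ = φ ≫ g := by
  let p := Projective.π B
  let S₂ : ShortComplex (ModuleCat.{v} R) := ShortComplex.mk (kernel.ι p) p (by simp)
  have h₂ : S₂.ShortExact :=
    { exact := ShortComplex.exact_of_f_is_kernel _ (kernelIsKernel p)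
      mono_f := inferInstanceAs (Mono (kernel.ι p))
      epi_g := inferInstanceAs (Epi (Projective.π B)) }
  let ι : kernel p ⟶ pullback p i := pullback.lift (kernel.ι p) 0 (by simp)
  have hι : ι ≫ pullback.fst p i = kernel.ι p := pullback.lift_fst _ _ _
  let S₁ : ShortComplex (ModuleCat.{v} R) :=
    ShortComplex.mk ι (pullback.snd p i) (pullback.lift_snd _ _ _)
  have h₁ : S₁.ShortExact := shortExact_pullback p i
  -- The identity on kernels makes the upper extension class the pullback along `i` of the lower
  -- one.
  let F : S₁ ⟶ S₂ :=
    { τ₁ := 𝟙 _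
      τ₂ := pullback.fst p i
      τ₃ := i
      comm₁₂ := by
        change 𝟙 _ ≫ kernel.ι p = ι ≫ pullback.fst p i
        rw [hι, Category.id_comp]
      comm₂₃ := pullback.condition }
  have hext : (Ext.mk₀ i).comp h₂.extClass (zero_add 1) = h₁.extClass := by
    have h := ShortComplex.ShortExact.extClass_naturality h₁ h₂ F
    rw [show F.τ₁ = 𝟙 _ from rfl, Ext.comp_mk₀_id] at h
    exact h.symm
  have key : ∀ {U V : ModuleCat.{v} R} (φ : kernel p ⟶ U) (g : U ⟶ V),
      (Ext.mk₀ i).comp ((h₂.extClass.comp (Ext.mk₀ φ) (add_zero 1)).comp (Ext.mk₀ g) (add_zero 1))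
        (zero_add 1) = h₁.extClass.comp (Ext.mk₀ (φ ≫ g)) (add_zero 1) := by
    intro U V φ g
    rw [Ext.comp_assoc_of_third_deg_zero, Ext.mk₀_comp_mk₀, ← hext,
      Ext.comp_assoc_of_third_deg_zero]
  refine ⟨kernel p, pullback p i, ι, fun {U V} g => ⟨fun h φ => ?_, fun h ξ => ?_⟩⟩
  · have h0 := h (h₂.extClass.comp (Ext.mk₀ φ) (add_zero 1))
    rw [key] at h0
    obtain ⟨x, hx⟩ := Ext.contravariant_sequence_exact₁ h₁ V _ (add_zero 1) h0
    obtain ⟨ψ, rfl⟩ := Ext.addEquiv₀.symm.surjective x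
    refine ⟨ψ, ?_⟩
    change (Ext.mk₀ ι).comp (Ext.mk₀ ψ) _ = _ at hx
    rw [Ext.mk₀_comp_mk₀] at hx
    exact Ext.addEquiv₀.symm.injective hx
  -- Since `Ext¹` out of the projective vanishes, every `ξ` is the presentation's class pushed out
  -- along some `φ`.
  · obtain ⟨x, rfl⟩ := Ext.contravariant_sequence_exact₃ h₂ U ξ
      (Ext.eq_zero_of_projective (P := Projective.over B) (n := 0) _) (add_zero 1)
    obtain ⟨φ, rfl⟩ := Ext.addEquiv₀.symm.surjective x
    obtain ⟨ψ, hψ⟩ := h φ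
    refine (key φ g).trans ?_
    rw [← hψ, ← Ext.mk₀_comp_mk₀]
    exact h₁.extClass_comp_assoc (Ext.mk₀ ψ)

/-- For an ideal generated by a family `f`, membership in the right orthogonal may be tested on the
generators. -/
theorem HomIdeal.mem_perp_span_iff {R : Type u} [Ring R] [Small.{v} R] {K : Type w}
    {M N : K → ModuleCat.{v} R} (f : ∀ k, M k ⟶ N k) {U V : ModuleCat.{v} R} (g : U ⟶ V) :
    g ∈ (span f).perp.homs U V ↔ ∀ k, ExtOneVanishes (f k) g := by
  refine ⟨fun h k => h _ _ _ fun I hI => hI k, fun h A B i hi => ?_⟩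
  let I : HomIdeal.{u, v} R :=
    { homs := fun A B =>
        { carrier := {i | ExtOneVanishes i g}
          zero_mem' := fun ξ => by simp
          add_mem' := fun {a b} ha hb ξ => by
            rw [Ext.mk₀_add, Ext.add_comp, ha ξ, hb ξ, add_zero]
          neg_mem' := fun {a} ha ξ => by
            have h : Ext.mk₀ (-a) = -Ext.mk₀ a :=
              eq_neg_of_add_eq_zero_left (by rw [← Ext.mk₀_add]; simp)
            rw [h, Ext.neg_comp, ha ξ, neg_zero] }
      precomp_mem := fun {A' A B} h {i} hi ξ => by
        rw [← Ext.mk₀_comp_mk₀, Ext.comp_assoc_of_second_deg_zero, hi ξ, Ext.comp_zero]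
      postcomp_mem := fun {A B B'} {i} h hi ξ => by
        have := hi ((Ext.mk₀ h).comp ξ (zero_add 1))
        rwa [Ext.comp_assoc_of_third_deg_zero, ← Ext.comp_assoc_of_second_deg_zero,
          Ext.mk₀_comp_mk₀] at this }
  exact hi I h

/-- A cardinal bounding, in terms of `c = #U`, the pushout of all `φ : L k ⟶ U` along `L k ⟶ E k`. -/
noncomputable def HomIdeal.pushoutBound {R : Type u} [Ring R] {K : Type v}
    (L E : K → ModuleCat.{v} R) (c : Cardinal.{v}) : Cardinal.{v} :=
  c * Cardinal.mk (Option (Σ k, E k)) ^ Cardinal.sum fun k => c ^ Cardinal.mk (L k)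

/-- The simultaneous pushout of all homomorphisms `φ : L k ⟶ U` along `ι k : L k ⟶ E k`. -/
theorem HomIdeal.exists_pushout {R : Type u} [Ring R] {K : Type v}
    {L E : K → ModuleCat.{v} R} (ι : ∀ k, L k ⟶ E k) (U : ModuleCat.{v} R) :
    ∃ (Q : ModuleCat.{v} R) (q : U ⟶ Q), Cardinal.mk Q ≤ pushoutBound L E (Cardinal.mk U) ∧
      (∀ k (φ : L k ⟶ U), ∃ ψ : E k ⟶ Q, ι k ≫ ψ = φ ≫ q) ∧
      ∀ (V : ModuleCat.{v} R) (g : U ⟶ V),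
        (∀ k (φ : L k ⟶ U), ∃ ψ : E k ⟶ V, ι k ≫ ψ = φ ≫ g) → ∃ h : Q ⟶ V, q ≫ h = g := by
  classical
  let T := Σ k, (L k ⟶ U)
  -- Dividing by the range of `r` identifies `φ x` with `ι k x` in the summand indexed by `(k, φ)`.
  let r : (Π₀ t : T, L t.1) →ₗ[R] U × Π₀ t : T, E t.1 :=
    DFinsupp.lsum ℕ fun t : T =>
      (t.2.hom.prod (-(DFinsupp.lsingle t ∘ₗ (ι t.1).hom)))
  have hr : ∀ (t : T) (x : L t.1),
      r (DFinsupp.single t x) = (t.2.hom x, -DFinsupp.single t ((ι t.1).hom x)) := by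
    intro t x
    refine (DFinsupp.lsum_single (S := ℕ) _ _ _).trans ?_
    rfl
  let S : Submodule R (U × Π₀ t : T, E t.1) := LinearMap.range r
  refine ⟨ModuleCat.of R ((U × Π₀ t : T, E t.1) ⧸ S), ModuleCat.ofHom (S.mkQ ∘ₗ LinearMap.inl R _ _), ?_, ?_, ?_⟩
  · calc Cardinal.mk ((U × Π₀ t : T, E t.1) ⧸ S) ≤ Cardinal.mk (U × Π₀ t : T, E t.1) :=
        Cardinal.mk_le_of_surjective S.mkQ_surjective
      _ = Cardinal.mk U * Cardinal.mk (Π₀ t : T, E t.1) := Cardinal.mk_prod _ _ |>.trans (by simp)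
      _ ≤ _ := by
        refine mul_le_mul_right ?_ _
        have h1 : Cardinal.mk (Π₀ t : T, E t.1) ≤ Cardinal.mk (T → Option (Σ k, E k)) := by
          refine Cardinal.mk_le_of_injective (f := fun x t => some ⟨t.1, x t⟩) fun x y hxy => ?_
          ext t
          simpa using congrFun hxy t
        have h2 : Cardinal.mk T ≤ Cardinal.sum fun k => Cardinal.mk U ^ Cardinal.mk (L k) := by
          rw [Cardinal.mk_sigma]
          refine Cardinal.sum_le_sum _ _ fun k => ?_
          rw [Cardinal.power_def]
          exact Cardinal.mk_le_of_injective (f := fun φ : L k ⟶ U => (φ.hom : L k → U))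
            fun a b hab => ModuleCat.hom_ext (DFunLike.coe_injective hab)
        refine h1.trans ?_
        rw [← Cardinal.power_def]
        -- Monotonicity in the exponent needs a nonzero base; `Option` ensures this even for empty
        -- `K`.
        exact Cardinal.power_le_power_left (Cardinal.mk_ne_zero _) h2
  · intro k φ
    refine ⟨ModuleCat.ofHom
      (S.mkQ ∘ₗ LinearMap.inr R _ _ ∘ₗ DFinsupp.lsingle (M := fun t : T => E t.1) ⟨k, φ⟩), ?_⟩
    ext x
    refine ((Submodule.Quotient.eq S).2 ⟨DFinsupp.single ⟨k, φ⟩ x, ?_⟩).symm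
    rw [hr]
    simp
    exact ⟨rfl, rfl⟩
  · intro V g hg
    choose ψ hψ using hg
    let s : (U × Π₀ t : T, E t.1) →ₗ[R] V :=
      LinearMap.coprod g.hom (DFinsupp.lsum ℕ fun t : T => (ψ t.1 t.2).hom)
    have hs : S ≤ LinearMap.ker s := by
      rw [LinearMap.range_le_ker_iff]
      refine DFinsupp.lhom_ext fun t x => ?_
      have h := congrArg (fun a => a.hom x) (hψ t.1 t.2)
      rw [LinearMap.comp_apply, hr]
      simp only [ModuleCat.hom_comp, LinearMap.comp_apply] at h
      refine (LinearMap.coprod_apply _ _ _).trans ?_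
      rw [map_neg, DFinsupp.lsum_single, h]
      simp
    refine ⟨ModuleCat.ofHom (S.liftQ s hs), ?_⟩
    ext x
    refine (LinearMap.coprod_apply _ _ _).trans ?_
    simp

/-- The homomorphisms with domain `U` in `J` whose codomain has cardinality at most `c` have a set of
representatives up to isomorphism under `U`. -/
theorem HomIdeal.exists_isAllSmallMaps {R : Type u} [Ring R] [Small.{v} R] (J : HomIdeal.{u, v} R)
    (c : Cardinal.{v}) (U : ModuleCat.{v} R) :
    ∃ (S : Type v) (V : S → ModuleCat.{v} R) (g : ∀ s, U ⟶ V s), J.IsAllSmallMaps c g := by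
  -- Every module of size at most `c` is a quotient of this free module, so its submodules index all
  -- codomains up to isomorphism.
  let F := c.out →₀ Shrink.{v} R
  let Y (N : Submodule R F) : ModuleCat.{v} R := ModuleCat.of R (F ⧸ N)
  let T := {p : Σ N : Submodule R F, (U ⟶ Y N) // p.2 ∈ J.homs U (Y p.1) ∧ Cardinal.mk (Y p.1) ≤ c}
  let r : Setoid T :=
    { r := fun p q => ∃ e : Y p.1.1 ≅ Y q.1.1, p.1.2 ≫ e.hom = q.1.2
      iseqv :=
        { refl := fun p => ⟨Iso.refl _, Category.comp_id _⟩
          symm := fun ⟨e, he⟩ => ⟨e.symm, by rw [← he]; simp⟩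
          trans := fun ⟨e, he⟩ ⟨e', he'⟩ => ⟨e ≪≫ e', by rw [← he', ← he]; simp⟩ } }
  refine ⟨Quotient r, fun s => Y s.out.1.1, fun s => s.out.1.2, fun s => s.out.2, ?_⟩
  intro W h hh hW
  obtain ⟨N, ⟨e⟩⟩ : ∃ N : Submodule R F, Nonempty (Y N ≅ W) := by
    rw [← c.mk_out] at hW
    obtain ⟨a, ha⟩ := (Cardinal.le_def _ _).1 hW |>.elim fun a =>
      (⟨Function.invFun a, Function.invFun_surjective a.injective⟩ :
        ∃ a : c.out → W, Function.Surjective a)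
    let l : F →ₗ[R] W :=
      Finsupp.linearCombination R a ∘ₗ
        (Finsupp.mapRange.linearEquiv (Shrink.linearEquiv.{v} R R)).toLinearMap
    have hl : Function.Surjective l :=
      (Finsupp.linearCombination_surjective R ha).comp (LinearEquiv.surjective _)
    exact ⟨LinearMap.ker l, ⟨(l.quotKerEquivOfSurjective hl).toModuleIso⟩⟩
  let t : T := ⟨⟨N, h ≫ e.inv⟩, J.postcomp_mem _ hh,
    (Cardinal.mk_congr e.toLinearEquiv.toEquiv).trans_le hW⟩
  refine ⟨Quotient.mk r t, ?_, ?_⟩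
  · obtain ⟨e', he'⟩ := Quotient.mk_out (s := r) t
    exact ⟨e' ≪≫ e, by
      rw [Iso.trans_hom, reassoc_of% he']
      simp [t]⟩
  · rintro s ⟨e', he'⟩
    rw [← Quotient.out_eq s]
    refine Quotient.sound (s := r) ⟨e' ≪≫ e.symm, ?_⟩
    rw [Iso.trans_hom, reassoc_of% he']
    rfl

theorem mainTheorem1 {R : Type u} [Ring R] [Small.{v} R] {K : Type w} [Small.{v} K]
    (M N : K → ModuleCat.{v} R) (f : ∀ k, M k ⟶ N k)
    (I : HomIdeal.{u, v} R) (hI : I = HomIdeal.span f) :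
    I.perp.IsPreenveloping ∧
      ∃ κ : Cardinal.{v} → Cardinal.{v}, ∀ U : ModuleCat.{v} R,
        (∃ (S : Type v) (V : S → ModuleCat.{v} R) (g : ∀ s, U ⟶ V s),
          I.perp.IsAllSmallMaps (κ (Cardinal.mk U)) g) ∧
        ∀ (S : Type v) (V : S → ModuleCat.{v} R) (g : ∀ s, U ⟶ V s),
          I.perp.IsAllSmallMaps (κ (Cardinal.mk U)) g →
            I.perp.IsPreenvelope (HomIdeal.toProduct g) := by
  subst hI
  choose L E ι hι using fun k : Shrink.{v} K =>
    HomIdeal.exists_extOneVanishes_iff_extends (f ((equivShrink K).symm k))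
  have mem_iff : ∀ {U V : ModuleCat.{v} R} (g : U ⟶ V),
      g ∈ (HomIdeal.span f).perp.homs U V ↔
        ∀ k (φ : L k ⟶ U), ∃ ψ : E k ⟶ V, ι k ≫ ψ = φ ≫ g := fun g => by
    rw [HomIdeal.mem_perp_span_iff, ← (equivShrink K).symm.forall_congr_right]
    exact forall_congr' fun k => hι k g
  have main : ∃ κ : Cardinal.{v} → Cardinal.{v}, ∀ U : ModuleCat.{v} R,
        (∃ (S : Type v) (V : S → ModuleCat.{v} R) (g : ∀ s, U ⟶ V s),
          (HomIdeal.span f).perp.IsAllSmallMaps (κ (Cardinal.mk U)) g) ∧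
        ∀ (S : Type v) (V : S → ModuleCat.{v} R) (g : ∀ s, U ⟶ V s),
          (HomIdeal.span f).perp.IsAllSmallMaps (κ (Cardinal.mk U)) g →
            (HomIdeal.span f).perp.IsPreenvelope (HomIdeal.toProduct g) := by
    refine ⟨HomIdeal.pushoutBound L E, fun U =>
      ⟨HomIdeal.exists_isAllSmallMaps _ _ U, fun S V g hg => ⟨?_, fun V' j' hj' => ?_⟩⟩⟩
    · rw [mem_iff]
      intro k φ
      choose ψ hψ using fun s => (mem_iff (g s)).1 (hg.1 s).1 k φ
      refine ⟨HomIdeal.toProduct ψ, ?_⟩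
      ext x s
      exact congrArg (fun a => a.hom x) (hψ s)
    · obtain ⟨Q, q, hQ, hq, huniv⟩ := HomIdeal.exists_pushout ι U
      obtain ⟨h, rfl⟩ := huniv V' j' ((mem_iff j').1 hj')
      -- The required factor is projection to the component isomorphic to `q`, followed by `e` and
      -- `h`.
      obtain ⟨s, ⟨e, rfl⟩, -⟩ := hg.2 Q q ((mem_iff q).2 hq) hQ
      exact ⟨ModuleCat.ofHom (LinearMap.proj s) ≫ e.hom ≫ h, by
        rw [Category.assoc]
        rfl⟩
  refine ⟨fun U => ?_, main⟩
  obtain ⟨κ, hκ⟩ := main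
  obtain ⟨⟨S, V, g, hg⟩, h⟩ := hκ U
  exact ⟨_, _, h S V g hg⟩
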